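/- Let $(\zeta_k)_{k\ge 0}$ be independent standard complex Gaussian random variables on a probability space (each $\zeta_k\sim N_{\mathbb C}(0,1)$, i.e. its real and imaginary parts are independent centered real Gaussians of variance $\tfrac12$). Let $$f_0(z)=\sum_{k=0}^\infty \zeta_k\frac{z^k}{\sqrt{k!}},\qquad f_n(z,\bar z)=\frac{1}{\sqrt{n!}}\,(\partial_z-\bar z)^n f_0(z)\quad (n\ge 0,\ z\in\mathbb C),$$ where $\partial_z=\tfrac12(\partial_x-i\,\partial_y)$ for $z=x+iy$, and set $$S_N(z)=\frac1N\sum_{n=0}^{N-1}\bigl|e^{-|z|^2/2}f_n(z,\bar z)\bigr|^2 .$$ Then for every compact set $K\subset\mathbb C$, almost surely the functions $S_N$ are continuous on $K$ and $S_N\to 1$ in $C(K)$, i.e. $$\sup_{z\in K}|S_N(z)-1|\to 0\quad\text{almost surely, as } N\to\infty .$$ -/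

import Mathlib

open MeasureTheory ProbabilityTheory Filter Topology

noncomputable section

/-- The standard complex Gaussian law `N_ℂ(0,1)`: the real and imaginary parts are independent
centered real Gaussians of variance `1/2`. -/
def stdComplexGaussian : Measure ℂ :=
  ((gaussianReal 0 (1 / 2)).prod (gaussianReal 0 (1 / 2))).map
    (fun p : ℝ × ℝ => (p.1 : ℂ) + (p.2 : ℂ) * Complex.I)

/-- The Wirtinger derivative `∂_z = (∂_x - i ∂_y) / 2`. -/
def wirtingerDeriv (F : ℂ → ℂ) (z : ℂ) : ℂ :=
  (1 / 2) * (fderiv ℝ F z 1 - Complex.I * fderiv ℝ F z Complex.I)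

/-- The Landau level raising operator `∂_z - z̄`. -/
def landauRaising (F : ℂ → ℂ) (z : ℂ) : ℂ :=
  wirtingerDeriv F z - (starRingEnd ℂ) z * F z

/-- The power series `f₀(z) = ∑ₖ aₖ zᵏ / √(k!)`. -/
def gefSeries (a : ℕ → ℂ) (z : ℂ) : ℂ :=
  ∑' k : ℕ, a k * (z ^ k / (Real.sqrt (k.factorial : ℝ) : ℂ))

/-- `fₙ(z, z̄) = (n!)^{-1/2} (∂_z - z̄)ⁿ f₀(z)`. -/
def landauField (a : ℕ → ℂ) (n : ℕ) (z : ℂ) : ℂ :=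
  (1 / (Real.sqrt (n.factorial : ℝ) : ℂ)) * (landauRaising^[n] (gefSeries a)) z

/-- `S_N(z) = N⁻¹ ∑_{n < N} |e^{-|z|²/2} fₙ(z, z̄)|²`. -/
def averagedField (a : ℕ → ℂ) (N : ℕ) (z : ℂ) : ℝ :=
  (1 / (N : ℝ)) * ∑ n ∈ Finset.range N,
    ‖(Real.exp (-‖z‖ ^ 2 / 2) : ℂ) * landauField a n z‖ ^ 2

end

/-! Along a ray `t ↦ t * w` the levels `gₙ(t) = exp(-|tw|²/2) fₙ(tw)` solve `gₙ' = w √(n+1) gₙ₊₁ -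
w̄ √n gₙ₋₁` (`hasDerivAt_radialLevel`), and `gₙ(0) = ζₙ`. The system is skew-Hermitian and
tridiagonal, so the mass `∑_{n<N} |gₙ|²` changes only by a flux of size `√N |g_N g_{N-1}|` through
its top edge. Averaging over edges `N, …, N+M-1` replaces this pointwise flux by a mass: the
averaged change is `O(N^{3/2} / M)` for `M ≤ N` (`IsLadderFlow.abs_window_sub_le`). With `M ≈ δN`
this is `o(N)`, so `S_N(z)` has the same limit as `S_N(0) = N⁻¹ ∑ |ζₙ|²`, uniformly for bounded `z`
(`tendstoUniformlyOn_averagedField`). Probability enters only through the strong law at the origin,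
so a single null set serves all `z`.

The flux estimate needs a linear mass bound at all times in `[0, 1]`. It comes from Gronwall applied
to a slowly varying weighted mass (`IsLadderFlow.mass_le`). Boundary terms at infinity are harmless
when the levels are bounded, which holds for truncated coefficients; the resulting bound does not
depend on the truncation and passes to the limit. -/

/-! ### Entire series with coefficients of at most exponential growth -/

/-- The coefficients of the derivative: `(gefSeries a)' = gefSeries (derivCoeff a)`. -/
noncomputable def derivCoeff (a : ℕ → ℂ) (k : ℕ) : ℂ := (Real.sqrt (k + 1) : ℂ) * a (k + 1)

/-- The sequence `a` grows at most exponentially. -/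
def ExpGrowth (a : ℕ → ℂ) : Prop := ∃ C D : ℝ, 0 ≤ C ∧ 0 ≤ D ∧ ∀ k, ‖a k‖ ≤ C * D ^ k

lemma ExpGrowth.derivCoeff {a : ℕ → ℂ} (ha : ExpGrowth a) : ExpGrowth (derivCoeff a) := by
  obtain ⟨C, D, hC, hD, h⟩ := ha
  refine ⟨C * D, 2 * D, by positivity, by positivity, fun k => ?_⟩
  have h1 : Real.sqrt ((k : ℝ) + 1) ≤ 2 ^ k := by
    have h2 : ((k : ℝ) + 1) ≤ 2 ^ k := by exact_mod_cast Nat.lt_two_pow_self (n := k)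
    rw [Real.sqrt_le_left (by positivity)]
    nlinarith [one_le_pow₀ (one_le_two (α := ℝ)) (n := k)]
  calc ‖_root_.derivCoeff a k‖ = Real.sqrt ((k : ℝ) + 1) * ‖a (k + 1)‖ := by
        rw [_root_.derivCoeff, norm_mul, Complex.norm_real, Real.norm_of_nonneg (Real.sqrt_nonneg _)]
    _ ≤ 2 ^ k * (C * D ^ (k + 1)) := by gcongr; exact h _
    _ = C * D * (2 * D) ^ k := by rw [mul_pow]; ring

lemma ExpGrowth.iterate_derivCoeff {a : ℕ → ℂ} (ha : ExpGrowth a) (j : ℕ) :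
    ExpGrowth (_root_.derivCoeff^[j] a) := by
  induction j with
  | zero => exact ha
  | succ j ih => rw [Function.iterate_succ_apply']; exact ih.derivCoeff

/-- The square of the left side is a term of the exponential series at `x²`, and `y² ≤ E` with `E ≥
1` forces `y ≤ E`. -/
lemma pow_div_sqrt_factorial_le {x : ℝ} (hx : 0 ≤ x) (n : ℕ) :
    x ^ n / Real.sqrt (n.factorial : ℝ) ≤ Real.exp (x ^ 2) := by
  have hn : (0 : ℝ) < n.factorial := by exact_mod_cast n.factorial_pos
  have h := Real.pow_div_factorial_le_exp (x ^ 2) (by positivity) n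
  have h1 : (1 : ℝ) ≤ Real.exp (x ^ 2) := Real.one_le_exp (by positivity)
  have h2 : (x ^ n / Real.sqrt (n.factorial : ℝ)) ^ 2 ≤ Real.exp (x ^ 2) := by
    rw [div_pow, Real.sq_sqrt hn.le, ← pow_mul, mul_comm n 2, pow_mul]; exact h
  have h3 : 0 ≤ x ^ n / Real.sqrt (n.factorial : ℝ) := by positivity
  nlinarith

lemma ExpGrowth.summable {a : ℕ → ℂ} (ha : ExpGrowth a) {r : ℝ} (hr : 0 ≤ r) :
    Summable fun k : ℕ => ‖a k‖ * (r ^ k / Real.sqrt (k.factorial : ℝ)) := by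
  obtain ⟨C, D, hC, hD, h⟩ := ha
  refine Summable.of_nonneg_of_le (fun k => by positivity) (fun k => ?_)
    ((summable_geometric_two).mul_left (C * Real.exp ((2 * D * r) ^ 2)))
  -- The extra factor 2 in the argument leaves `(1/2)^k` for summation.
  have h1 := pow_div_sqrt_factorial_le (x := 2 * D * r) (by positivity) k
  calc ‖a k‖ * (r ^ k / Real.sqrt (k.factorial : ℝ))
      ≤ C * D ^ k * (r ^ k / Real.sqrt (k.factorial : ℝ)) := by gcongr; exact h k
    _ = C * ((2 * D * r) ^ k / Real.sqrt (k.factorial : ℝ)) * (1 / 2) ^ k := by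
        rw [mul_pow, mul_pow, one_div, inv_pow]; field_simp
    _ ≤ C * Real.exp ((2 * D * r) ^ 2) * (1 / 2) ^ k := by gcongr

lemma norm_gefTerm (a : ℕ → ℂ) (k : ℕ) (z : ℂ) :
    ‖a k * (z ^ k / (Real.sqrt (k.factorial : ℝ) : ℂ))‖
      = ‖a k‖ * (‖z‖ ^ k / Real.sqrt (k.factorial : ℝ)) := by
  rw [norm_mul, norm_div, norm_pow, Complex.norm_real, Real.norm_of_nonneg (Real.sqrt_nonneg _)]

lemma succ_div_sqrt_factorial_succ (k : ℕ) :
    ((k : ℝ) + 1) / Real.sqrt ((k + 1).factorial : ℝ)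
      = Real.sqrt (k + 1) / Real.sqrt (k.factorial : ℝ) := by
  have h : (0 : ℝ) < (k : ℝ) + 1 := by positivity
  have h' : (0 : ℝ) < k.factorial := by exact_mod_cast k.factorial_pos
  rw [Nat.factorial_succ, Nat.cast_mul, Real.sqrt_mul (by positivity)]
  push_cast
  have := Real.mul_self_sqrt h.le
  have h1 := Real.sqrt_pos.2 h
  have h2 := Real.sqrt_pos.2 h'
  field_simp
  nlinarith

/-- Termwise differentiation: on a ball of radius `R = |z| + 1` the differentiated terms are
dominated by their norms at `R`. The constant term drops out, and shifting the index produces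
`derivCoeff`. -/
lemma hasDerivAt_gefSeries {a : ℕ → ℂ} (ha : ExpGrowth a) (z : ℂ) :
    HasDerivAt (gefSeries a) (gefSeries (derivCoeff a) z) z := by
  set g' : ℕ → ℂ → ℂ := fun k z => a k * ((k : ℂ) * z ^ (k - 1) / (Real.sqrt (k.factorial : ℝ) : ℂ))
    with hg'
  have hsucc : ∀ k z, g' (k + 1) z
      = derivCoeff a k * (z ^ k / (Real.sqrt (k.factorial : ℝ) : ℂ)) := by
    intro k z
    have h := congrArg (fun x : ℝ => (x : ℂ)) (succ_div_sqrt_factorial_succ k)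
    push_cast at h
    simp only [hg', derivCoeff, Nat.add_sub_cancel]
    push_cast
    calc _ = a (k + 1) * z ^ k * (((k : ℂ) + 1) / (Real.sqrt ((k + 1).factorial : ℝ) : ℂ)) := by ring
      _ = _ := by rw [h]; ring
  have hzero : ∀ z, g' 0 z = 0 := fun z => by simp [hg']
  set R : ℝ := ‖z‖ + 1
  have hR : 0 ≤ R := by positivity
  have hS : Summable fun k => ‖g' k (R : ℂ)‖ := by
    rw [← summable_nat_add_iff 1]
    refine (ha.derivCoeff.summable hR).congr fun k => ?_
    rw [hsucc, norm_gefTerm, Complex.norm_real, Real.norm_of_nonneg hR]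
  have hmono : ∀ k, ∀ y ∈ Metric.ball (0 : ℂ) R, ‖g' k y‖ ≤ ‖g' k (R : ℂ)‖ := by
    intro k y hy
    have hy' : ‖y‖ ≤ R := by simpa using (Metric.mem_ball.1 hy).le
    cases k with
    | zero => simp [hzero]
    | succ k =>
      rw [hsucc, hsucc, norm_gefTerm, norm_gefTerm, Complex.norm_real, Real.norm_of_nonneg hR]
      gcongr
  have hmem : z ∈ Metric.ball (0 : ℂ) R := by simp [R]
  have hsum : Summable fun k : ℕ => a k * (z ^ k / (Real.sqrt (k.factorial : ℝ) : ℂ)) :=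
    Summable.of_norm ((ha.summable (norm_nonneg z)).congr fun k => (norm_gefTerm a k z).symm)
  have key := hasDerivAt_tsum_of_isPreconnected (𝕜 := ℂ)
    (g := fun k z => a k * (z ^ k / (Real.sqrt (k.factorial : ℝ) : ℂ))) (g' := g')
    hS Metric.isOpen_ball (convex_ball (0 : ℂ) R).isPreconnected
    (fun k y _ => ((hasDerivAt_pow k y).div_const _).const_mul _) hmono hmem hsum hmem
  have hsum' : Summable fun k => g' k z :=
    Summable.of_norm (Summable.of_nonneg_of_le (fun _ => norm_nonneg _)
      (fun k => hmono k z hmem) hS)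
  have heq : ∑' k, g' k z = gefSeries (derivCoeff a) z := by
    rw [hsum'.tsum_eq_zero_add, hzero, zero_add]
    exact tsum_congr fun k => hsucc k z
  rw [heq] at key
  exact key

/-! ### Truncation of the coefficients -/

/-- The sequence `a` with all coefficients of index at least `L` set to zero. -/
noncomputable def truncCoeff (a : ℕ → ℂ) (L k : ℕ) : ℂ := if k < L then a k else 0

lemma norm_truncCoeff_le (a : ℕ → ℂ) (L k : ℕ) : ‖truncCoeff a L k‖ ≤ ‖a k‖ := by
  rw [truncCoeff]; split_ifs <;> simp

lemma iterate_derivCoeff_truncCoeff (a : ℕ → ℂ) (L j k : ℕ) :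
    derivCoeff^[j] (truncCoeff a L) k = if k + j < L then derivCoeff^[j] a k else 0 := by
  induction j generalizing k with
  | zero => rfl
  | succ j ih =>
    rw [Function.iterate_succ_apply', Function.iterate_succ_apply', derivCoeff, ih, derivCoeff,
      show k + 1 + j = k + (j + 1) by ring]
    split_ifs <;> simp

lemma ExpGrowth.truncCoeff {a : ℕ → ℂ} (ha : ExpGrowth a) (L : ℕ) :
    ExpGrowth (_root_.truncCoeff a L) := by
  obtain ⟨C, D, hC, hD, h⟩ := ha
  exact ⟨C, D, hC, hD, fun k => (norm_truncCoeff_le a L k).trans (h k)⟩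

lemma tendsto_gefSeries_truncCoeff {a : ℕ → ℂ} (ha : ExpGrowth a) (j : ℕ) (z : ℂ) :
    Tendsto (fun L => gefSeries (derivCoeff^[j] (truncCoeff a L)) z) atTop
      (𝓝 (gefSeries (derivCoeff^[j] a) z)) := by
  refine tendsto_tsum_of_dominated_convergence
    ((ha.iterate_derivCoeff j).summable (norm_nonneg z)) (fun k => ?_)
    (Eventually.of_forall fun L k => ?_)
  · refine tendsto_const_nhds.congr' ?_
    filter_upwards [eventually_gt_atTop (k + j)] with L hL
    rw [iterate_derivCoeff_truncCoeff, if_pos hL]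
  · rw [norm_gefTerm, iterate_derivCoeff_truncCoeff]
    gcongr
    split_ifs <;> simp

/-! ### The Landau levels and their Wirtinger derivatives -/

/-- `F` is real differentiable at `z`, with `∂_z F = p` and `∂_{z̄} F = q`. -/
def HasWirtingerAt (F : ℂ → ℂ) (p q z : ℂ) : Prop :=
  HasFDerivAt F (p • ContinuousLinearMap.id ℝ ℂ + q • (Complex.conjCLE : ℂ →L[ℝ] ℂ)) z

lemma HasWirtingerAt.hasFDerivAt {F : ℂ → ℂ} {p q z : ℂ} (h : HasWirtingerAt F p q z) :
    HasFDerivAt F (p • ContinuousLinearMap.id ℝ ℂ + q • (Complex.conjCLE : ℂ →L[ℝ] ℂ)) z := h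

lemma HasWirtingerAt.wirtingerDeriv_eq {F : ℂ → ℂ} {p q z : ℂ} (h : HasWirtingerAt F p q z) :
    wirtingerDeriv F z = p := by
  rw [wirtingerDeriv, h.hasFDerivAt.fderiv]
  simp
  linear_combination (-(1 / 2) * p + 1 / 2 * q) * Complex.I_mul_I

lemma hasWirtingerAt_of_hasDerivAt {F : ℂ → ℂ} {p z : ℂ} (h : HasDerivAt F p z) :
    HasWirtingerAt F p 0 z := by
  refine (h.hasFDerivAt.restrictScalars ℝ).congr_fderiv ?_
  ext
  simp [mul_comm]

lemma HasWirtingerAt.sub_conj_mul {F G : ℂ → ℂ} {p q r s z : ℂ}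
    (hF : HasWirtingerAt F p q z) (hG : HasWirtingerAt G r s z) :
    HasWirtingerAt (fun z => F z - (starRingEnd ℂ) z * G z)
      (p - (starRingEnd ℂ) z * r) (q - (starRingEnd ℂ) z * s - G z) z := by
  have hc : HasFDerivAt (fun z : ℂ => (starRingEnd ℂ) z) (Complex.conjCLE : ℂ →L[ℝ] ℂ) z :=
    Complex.conjCLE.hasFDerivAt
  refine (hF.hasFDerivAt.sub (hc.mul hG.hasFDerivAt)).congr_fderiv ?_
  ext v
  simp
  ring

/-- `(∂_z - z̄)ⁿ ∂_zʲ` applied to the series with coefficients `a`. -/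
noncomputable def landauTower (a : ℕ → ℂ) : ℕ → ℕ → ℂ → ℂ
  | 0, j, z => gefSeries (derivCoeff^[j] a) z
  | n + 1, j, z => landauTower a n (j + 1) z - (starRingEnd ℂ) z * landauTower a n j z

/-- `∂_z` commutes with `∂_z - z̄`, so it only raises `j`. The commutator `[∂_{z̄}, ∂_z - z̄] = -1`
and holomorphy of the base series give `-n` times the level below; at `n = 0` the truncated `n - 1`
is killed by the factor `n`. -/
lemma hasWirtingerAt_landauTower {a : ℕ → ℂ} (ha : ExpGrowth a) (n j : ℕ) (z : ℂ) :
    HasWirtingerAt (landauTower a n j) (landauTower a n (j + 1) z)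
      (-n * landauTower a (n - 1) j z) z := by
  induction n generalizing j with
  | zero =>
    have h := hasDerivAt_gefSeries (ha.iterate_derivCoeff j) z
    rw [← Function.iterate_succ_apply' derivCoeff j a] at h
    simpa [landauTower] using hasWirtingerAt_of_hasDerivAt h
  | succ n ih =>
    have h := (ih (j + 1)).sub_conj_mul (ih j)
    have hq : -((n + 1 : ℕ) : ℂ) * landauTower a (n + 1 - 1) j z
        = -n * landauTower a (n - 1) (j + 1) z
          - (starRingEnd ℂ) z * (-n * landauTower a (n - 1) j z) - landauTower a n j z := by
      cases n with
      | zero => simp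
      | succ n => simp only [landauTower, Nat.add_sub_cancel]; push_cast; ring
    rw [hq]
    exact h

lemma iterate_landauRaising_gefSeries {a : ℕ → ℂ} (ha : ExpGrowth a) (n : ℕ) :
    landauRaising^[n] (gefSeries a) = landauTower a n 0 := by
  induction n with
  | zero => rfl
  | succ n ih =>
    rw [Function.iterate_succ_apply', ih]
    ext z
    rw [landauRaising, (hasWirtingerAt_landauTower ha n 0 z).wirtingerDeriv_eq]
    rfl

lemma landauField_eq {a : ℕ → ℂ} (ha : ExpGrowth a) (n : ℕ) (z : ℂ) :
    landauField a n z = (1 / (Real.sqrt (n.factorial : ℝ) : ℂ)) * landauTower a n 0 z := by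
  rw [landauField, iterate_landauRaising_gefSeries ha]

lemma continuous_landauField {a : ℕ → ℂ} (ha : ExpGrowth a) (n : ℕ) :
    Continuous (landauField a n) := by
  have h : Continuous (landauTower a n 0) := continuous_iff_continuousAt.2 fun z =>
    (hasWirtingerAt_landauTower ha n 0 z).hasFDerivAt.continuousAt
  exact (continuous_const.mul h).congr fun z => (landauField_eq ha n z).symm

lemma continuous_averagedField {a : ℕ → ℂ} (ha : ExpGrowth a) (N : ℕ) :
    Continuous (averagedField a N) := by
  unfold averagedField
  have := continuous_landauField ha
  fun_prop

lemma tendsto_landauTower_truncCoeff {a : ℕ → ℂ} (ha : ExpGrowth a) (n j : ℕ) (z : ℂ) :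
    Tendsto (fun L => landauTower (truncCoeff a L) n j z) atTop (𝓝 (landauTower a n j z)) := by
  induction n generalizing j with
  | zero => exact tendsto_gefSeries_truncCoeff ha j z
  | succ n ih => exact (ih (j + 1)).sub ((ih j).const_mul _)

lemma norm_landauTower_le {a : ℕ → ℂ} {C R : ℝ} {z : ℂ}
    (hC : ∀ j, ‖gefSeries (derivCoeff^[j] a) z‖ ≤ C) (hz : ‖z‖ ≤ R) (n j : ℕ) :
    ‖landauTower a n j z‖ ≤ C * (1 + R) ^ n := by
  have hR : 0 ≤ R := (norm_nonneg z).trans hz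
  induction n generalizing j with
  | zero => simpa [landauTower] using hC j
  | succ n ih =>
    calc ‖landauTower a (n + 1) j z‖
        ≤ ‖landauTower a n (j + 1) z‖ + ‖z‖ * ‖landauTower a n j z‖ := by
          refine (norm_sub_le _ _).trans_eq ?_
          rw [norm_mul, Complex.norm_conj]
      _ ≤ C * (1 + R) ^ n + R * (C * (1 + R) ^ n) := by gcongr <;> exact ih _
      _ = C * (1 + R) ^ (n + 1) := by ring

/-- A polynomial has finitely many nonzero derivatives, hence one bound for all of them on the disc.
Each raising step costs at most `1 + R`, and `(1 + R)^n / √n!` is bounded. -/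
lemma exists_bound_landauField_truncCoeff {a : ℕ → ℂ} (ha : ExpGrowth a) (L : ℕ) (R : ℝ) :
    ∃ Q, ∀ n z, ‖z‖ ≤ R → ‖landauField (truncCoeff a L) n z‖ ≤ Q := by
  obtain hR | hR := lt_or_ge R 0
  · exact ⟨0, fun n z hz => absurd ((norm_nonneg z).trans hz) hR.not_ge⟩
  have hb : ∀ j, ∃ C, ∀ z ∈ Metric.closedBall (0 : ℂ) R,
      ‖gefSeries (derivCoeff^[j] (truncCoeff a L)) z‖ ≤ C := fun j =>
    (isCompact_closedBall (0 : ℂ) R).exists_bound_of_continuousOn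
      (continuous_iff_continuousAt.2 fun z => (hasDerivAt_gefSeries
        ((ha.truncCoeff L).iterate_derivCoeff j) z).continuousAt).continuousOn
  choose C hC using hb
  have h0 : (0 : ℂ) ∈ Metric.closedBall (0 : ℂ) R := by simpa using hR
  have hC0 : ∀ j, 0 ≤ C j := fun j => (norm_nonneg _).trans (hC j 0 h0)
  have hall : ∀ z, ‖z‖ ≤ R → ∀ j,
      ‖gefSeries (derivCoeff^[j] (truncCoeff a L)) z‖ ≤ ∑ i ∈ Finset.range L, C i := by
    intro z hz j
    by_cases hj : j < L
    · exact (hC j z (by simpa using hz)).trans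
        (Finset.single_le_sum (fun i _ => hC0 i) (Finset.mem_range.2 hj))
    · have : gefSeries (derivCoeff^[j] (truncCoeff a L)) z = 0 := by
        simp [gefSeries, iterate_derivCoeff_truncCoeff, show ∀ k, ¬ k + j < L by intro k; omega]
      rw [this, norm_zero]
      exact Finset.sum_nonneg fun i _ => hC0 i
  refine ⟨(∑ i ∈ Finset.range L, C i) * Real.exp ((1 + R) ^ 2), fun n z hz => ?_⟩
  rw [landauField_eq (ha.truncCoeff L), norm_mul, norm_div, norm_one, Complex.norm_real,
    Real.norm_of_nonneg (Real.sqrt_nonneg _)]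
  calc 1 / Real.sqrt (n.factorial : ℝ) * ‖landauTower (truncCoeff a L) n 0 z‖
      ≤ 1 / Real.sqrt (n.factorial : ℝ) * ((∑ i ∈ Finset.range L, C i) * (1 + R) ^ n) := by
        gcongr; exact norm_landauTower_le (hall z hz) hz n 0
    _ = (∑ i ∈ Finset.range L, C i) * ((1 + R) ^ n / Real.sqrt (n.factorial : ℝ)) := by ring
    _ ≤ _ := by
        gcongr
        · exact Finset.sum_nonneg fun i _ => hC0 i
        · exact pow_div_sqrt_factorial_le (by positivity) n

/-- At the origin the `z̄` terms vanish, leaving the `n`-th Taylor derivative `√n! aₙ`. This is the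
initial datum of the radial flow. -/
lemma landauField_zero_right {a : ℕ → ℂ} (ha : ExpGrowth a) (n : ℕ) : landauField a n 0 = a n := by
  have h1 : ∀ n j, landauTower a n j 0 = derivCoeff^[n + j] a 0 := by
    intro n
    induction n with
    | zero =>
      intro j
      rw [landauTower, gefSeries, tsum_eq_single 0 fun k hk => by simp [hk]]
      simp
    | succ n ih => intro j; simp [landauTower, ih, add_assoc, add_comm 1 j]
  have h2 : ∀ n k, derivCoeff^[n] a k * (Real.sqrt (k.factorial : ℝ) : ℂ)
      = (Real.sqrt ((n + k).factorial : ℝ) : ℂ) * a (n + k) := by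
    intro n
    induction n with
    | zero => intro k; simp [mul_comm]
    | succ n ih =>
      intro k
      have := ih (k + 1)
      rw [show n + (k + 1) = n + 1 + k by ring] at this
      rw [← this, Function.iterate_succ_apply', derivCoeff, Nat.factorial_succ k, Nat.cast_mul,
        Real.sqrt_mul (by positivity)]
      push_cast; ring
  have h3 := h2 n 0
  have h4 : (Real.sqrt (n.factorial : ℝ) : ℂ) ≠ 0 := by
    have : (0 : ℝ) < n.factorial := by exact_mod_cast n.factorial_pos
    exact_mod_cast (Real.sqrt_pos.2 this).ne'
  rw [landauField_eq ha, h1]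
  simp at h3
  simp [h3, h4]

/-! ### The radial flow -/

/-- The normalised Landau levels along the ray through `w`. -/
noncomputable def radialLevel (a : ℕ → ℂ) (w : ℂ) (n : ℕ) (t : ℝ) : ℂ :=
  (Real.exp (-‖(t : ℂ) * w‖ ^ 2 / 2) : ℂ) * landauField a n (t * w)

/-- The radial derivative is `w ∂_z + w̄ ∂_{z̄}`. Differentiating the Gaussian contributes `-t|w|² =
-w · conj(tw)`, which completes `w ∂_z` to `w (∂_z - z̄)`, the raising operator; `∂_{z̄}` lowers.
The factorial normalisation yields the square roots. -/
lemma hasDerivAt_radialLevel {a : ℕ → ℂ} (ha : ExpGrowth a) (w : ℂ) (n : ℕ) (t : ℝ) :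
    HasDerivAt (radialLevel a w n)
      (w * (Real.sqrt (n + 1) : ℂ) * radialLevel a w (n + 1) t
        - (starRingEnd ℂ) w * (Real.sqrt n : ℂ) * radialLevel a w (n - 1) t) t := by
  have hw : HasDerivAt (fun t : ℝ => (t : ℂ) * w) w t := by
    simpa using (Complex.ofRealCLM.hasDerivAt (x := t)).mul_const w
  have hT := (hasWirtingerAt_landauTower ha n 0 ((t : ℂ) * w)).hasFDerivAt.comp_hasDerivAt t hw
  have hE : HasDerivAt (fun t : ℝ => (Real.exp (-‖(t : ℂ) * w‖ ^ 2 / 2) : ℂ))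
      ((Real.exp (-‖(t : ℂ) * w‖ ^ 2 / 2) * (-t * ‖w‖ ^ 2) : ℝ) : ℂ) t := by
    have h0 : HasDerivAt (fun t : ℝ => -‖(t : ℂ) * w‖ ^ 2 / 2) (-t * ‖w‖ ^ 2) t := by
      have h1 : (fun t : ℝ => -‖(t : ℂ) * w‖ ^ 2 / 2) = fun t : ℝ => t ^ 2 * (-‖w‖ ^ 2 / 2) := by
        ext t
        rw [norm_mul, mul_pow, Complex.norm_real, Real.norm_eq_abs, sq_abs]; ring
      rw [h1]
      refine ((hasDerivAt_pow 2 t).mul_const (-‖w‖ ^ 2 / 2)).congr_deriv ?_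
      push_cast; ring
    exact h0.exp.ofReal_comp
  have h := hE.mul (hT.const_mul (1 / (Real.sqrt (n.factorial : ℝ) : ℂ)))
  have hfun : radialLevel a w n = fun t : ℝ => (Real.exp (-‖(t : ℂ) * w‖ ^ 2 / 2) : ℂ)
      * ((1 / (Real.sqrt (n.factorial : ℝ) : ℂ)) * (landauTower a n 0 ∘ fun t : ℝ => (t : ℂ) * w) t) := by
    ext t; rw [radialLevel, landauField_eq ha]; rfl
  rw [hfun]
  refine h.congr_deriv ?_
  have hsq : ∀ m : ℕ, (Real.sqrt (m.factorial : ℝ) : ℂ) ≠ 0 := fun m => by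
    have : (0 : ℝ) < m.factorial := by exact_mod_cast m.factorial_pos
    exact_mod_cast (Real.sqrt_pos.2 this).ne'
  have hsq1 : ∀ m : ℕ, (Real.sqrt ((m : ℝ) + 1) : ℂ) ≠ 0 := fun m => by
    have : (0 : ℝ) < (m : ℝ) + 1 := by positivity
    exact_mod_cast (Real.sqrt_pos.2 this).ne'
  have hsucc : ∀ m : ℕ, (Real.sqrt ((m + 1).factorial : ℝ) : ℂ)
      = (Real.sqrt ((m : ℝ) + 1) : ℂ) * (Real.sqrt (m.factorial : ℝ) : ℂ) := fun m => by
    rw [Nat.factorial_succ, Nat.cast_mul, Real.sqrt_mul (by positivity)]; push_cast; rfl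
  have hww : ((‖w‖ : ℂ)) ^ 2 = (starRingEnd ℂ) w * w := (Complex.conj_mul' w).symm
  have hup : (Real.sqrt ((n : ℝ) + 1) : ℂ) * (1 / (Real.sqrt ((n + 1).factorial : ℝ) : ℂ))
      = 1 / (Real.sqrt (n.factorial : ℝ) : ℂ) := by
    rw [hsucc]; field_simp [hsq n, hsq1 n]
  have hdown : (Real.sqrt (n : ℝ) : ℂ) * (1 / (Real.sqrt ((n - 1).factorial : ℝ) : ℂ))
      = n * (1 / (Real.sqrt (n.factorial : ℝ) : ℂ)) := by
    cases n with
    | zero => simp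
    | succ m =>
      have h5 : (Real.sqrt ((m : ℝ) + 1) : ℂ) ^ 2 = (m : ℂ) + 1 := by
        rw [← Complex.ofReal_pow, Real.sq_sqrt (by positivity)]; push_cast; rfl
      rw [hsucc, Nat.add_sub_cancel]
      push_cast
      rw [← h5]
      field_simp [hsq m, hsq1 m]
  simp only [radialLevel, landauField_eq ha, Function.comp]
  have hstep : landauTower a (n + 1) 0 ((t : ℂ) * w) = landauTower a n 1 ((t : ℂ) * w)
      - (starRingEnd ℂ) ((t : ℂ) * w) * landauTower a n 0 ((t : ℂ) * w) := rfl
  rw [hstep]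
  rw [one_div, one_div] at hup hdown
  simp
  generalize Complex.exp (-(↑|t| * ↑‖w‖) ^ 2 / 2) = E
  generalize landauTower a n 1 ((t : ℂ) * w) = X
  generalize landauTower a n 0 ((t : ℂ) * w) = Y
  generalize landauTower a (n - 1) 0 ((t : ℂ) * w) = Z
  linear_combination (-E * w * (X - t * (starRingEnd ℂ) w * Y)) * hup
    + (starRingEnd ℂ) w * E * Z * hdown - E * t * (Real.sqrt (n.factorial : ℝ) : ℂ)⁻¹ * Y * hww

/-! ### The tridiagonal flow -/

/-- The sequence `g` solves the linear system `gₙ' = w √(n+1) gₙ₊₁ - w̄ √n gₙ₋₁`. -/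
def IsLadderFlow (w : ℂ) (g : ℕ → ℝ → ℂ) : Prop :=
  ∀ n t, HasDerivAt (g n) (w * (Real.sqrt (n + 1) : ℂ) * g (n + 1) t
    - (starRingEnd ℂ) w * (Real.sqrt n : ℂ) * g (n - 1) t) t

/-- The flux of mass into the levels below `n`. -/
noncomputable def ladderFlux (w : ℂ) (g : ℕ → ℝ → ℂ) (n : ℕ) (t : ℝ) : ℝ :=
  2 * Real.sqrt n * (w * g n t * (starRingEnd ℂ) (g (n - 1) t)).re

lemma ladderFlux_zero (w : ℂ) (g : ℕ → ℝ → ℂ) (t : ℝ) : ladderFlux w g 0 t = 0 := by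
  simp [ladderFlux]

lemma abs_ladderFlux_le (w : ℂ) (g : ℕ → ℝ → ℂ) (n : ℕ) (t : ℝ) :
    |ladderFlux w g n t| ≤ ‖w‖ * Real.sqrt n * (‖g n t‖ ^ 2 + ‖g (n - 1) t‖ ^ 2) := by
  have h1 := Complex.abs_re_le_norm (w * g n t * (starRingEnd ℂ) (g (n - 1) t))
  rw [norm_mul, norm_mul, Complex.norm_conj] at h1
  rw [ladderFlux, abs_mul, abs_of_nonneg (by positivity)]
  calc _ ≤ 2 * Real.sqrt n * (‖w‖ * ‖g n t‖ * ‖g (n - 1) t‖) := by gcongr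
    _ = ‖w‖ * Real.sqrt n * (2 * ‖g n t‖ * ‖g (n - 1) t‖) := by ring
    _ ≤ _ := by gcongr; exact two_mul_le_add_sq _ _

/-- Skew-Hermitian couplings: what level `n` gains from `n + 1` is exactly what `n + 1` loses, so
sums over levels telescope. -/
lemma IsLadderFlow.hasDerivAt_norm_sq {w : ℂ} {g : ℕ → ℝ → ℂ} (hg : IsLadderFlow w g)
    (n : ℕ) (t : ℝ) :
    HasDerivAt (fun t => ‖g n t‖ ^ 2) (ladderFlux w g (n + 1) t - ladderFlux w g n t) t := by
  refine (hg n t).norm_sq.congr_deriv ?_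
  rw [Complex.inner]
  simp [ladderFlux]
  ring

lemma IsLadderFlow.hasDerivAt_mass {w : ℂ} {g : ℕ → ℝ → ℂ} (hg : IsLadderFlow w g)
    (N : ℕ) (t : ℝ) :
    HasDerivAt (fun t => ∑ n ∈ Finset.range N, ‖g n t‖ ^ 2) (ladderFlux w g N t) t := by
  refine (HasDerivAt.fun_sum fun n _ => hg.hasDerivAt_norm_sq n t).congr_deriv ?_
  rw [Finset.sum_range_sub (fun n => ladderFlux w g n t), ladderFlux_zero, sub_zero]

lemma sum_mul_sub_eq {φ F : ℕ → ℝ} (hF : F 0 = 0) (M : ℕ) :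
    ∑ n ∈ Finset.range M, φ n * (F (n + 1) - F n)
      = φ M * F M + ∑ n ∈ Finset.range M, (φ n - φ (n + 1)) * F (n + 1) := by
  induction M with
  | zero => simp [hF]
  | succ M ih => rw [Finset.sum_range_succ, ih, Finset.sum_range_succ]; ring

/-- Summation by parts on both `b` and the constant sequence `B`; the partial sums then appear with
nonnegative coefficients. -/
lemma sum_mul_le_of_antitone {φ b : ℕ → ℝ} {B : ℝ} (hφ : ∀ n, 0 ≤ φ n)
    (hanti : ∀ n, φ (n + 1) ≤ φ n) (hb : ∀ n : ℕ, ∑ k ∈ Finset.range n, b k ≤ B * n) (M : ℕ) :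
    ∑ n ∈ Finset.range M, φ n * b n ≤ B * ∑ n ∈ Finset.range M, φ n := by
  have h1 := sum_mul_sub_eq (φ := φ) (F := fun n => ∑ k ∈ Finset.range n, b k) (by simp) M
  have h2 := sum_mul_sub_eq (φ := φ) (F := fun n : ℕ => B * n) (by simp) M
  simp only [Finset.sum_range_succ, add_sub_cancel_left] at h1
  have h3 : ∑ n ∈ Finset.range M, φ n * (B * ((n + 1 : ℕ) : ℝ) - B * n)
      = B * ∑ n ∈ Finset.range M, φ n := by
    rw [Finset.mul_sum]
    exact Finset.sum_congr rfl fun n _ => by push_cast; ring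
  rw [h1, ← h3, h2]
  gcongr with n _
  · exact hφ M
  · exact hb M
  · exact sub_nonneg.2 (hanti n)
  · have := hb (n + 1)
    rwa [Finset.sum_range_succ] at this

/-- The weight `N² / ((N + n) (N + n + 1))`, which varies slowly on the scale `√n`. -/
noncomputable def ladderWeight (N n : ℕ) : ℝ := N ^ 2 / ((N + n) * (N + n + 1))

lemma ladderWeight_nonneg (N n : ℕ) : 0 ≤ ladderWeight N n := by
  rw [ladderWeight]; positivity

lemma ladderWeight_sub {N : ℕ} (hN : 1 ≤ N) (n : ℕ) :
    ladderWeight N n - ladderWeight N (n + 1) = 2 / (N + n) * ladderWeight N (n + 1) := by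
  have : (0 : ℝ) < N := by exact_mod_cast hN
  rw [ladderWeight, ladderWeight]
  push_cast
  field_simp
  ring

lemma ladderWeight_succ_le {N : ℕ} (hN : 1 ≤ N) (n : ℕ) :
    ladderWeight N (n + 1) ≤ ladderWeight N n := by
  have h := ladderWeight_sub hN n
  have h1 : 0 ≤ 2 / ((N : ℝ) + n) * ladderWeight N (n + 1) :=
    mul_nonneg (by positivity) (ladderWeight_nonneg _ _)
  linarith

/-- The relative decrement `2 / (N + n)` of the weight absorbs the `√n` in the flux, with a constant
free of `N`; hence a Gronwall rate free of `N`. -/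
lemma ladderWeight_sub_mul_sqrt_le {N : ℕ} (hN : 1 ≤ N) (n : ℕ) :
    (ladderWeight N n - ladderWeight N (n + 1)) * Real.sqrt ((n + 1 : ℕ) : ℝ)
      ≤ 2 * ladderWeight N (n + 1) := by
  have hN' : (1 : ℝ) ≤ N := by exact_mod_cast hN
  rw [ladderWeight_sub hN]
  have h1 : Real.sqrt ((n + 1 : ℕ) : ℝ) ≤ N + n := by
    rw [Real.sqrt_le_left (by positivity)]
    push_cast
    nlinarith [(Nat.cast_nonneg n : (0 : ℝ) ≤ n)]
  calc _ ≤ 2 / ((N : ℝ) + n) * ladderWeight N (n + 1) * (N + n) := by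
        gcongr; exact mul_nonneg (by positivity) (ladderWeight_nonneg _ _)
    _ = _ := by field_simp

/-- The weight is the difference of `N² / (N + n)` at consecutive `n`. -/
lemma sum_ladderWeight_le {N : ℕ} (hN : 1 ≤ N) (M : ℕ) :
    ∑ n ∈ Finset.range M, ladderWeight N n ≤ N := by
  have hN' : (0 : ℝ) < N := by exact_mod_cast hN
  have h : ∑ n ∈ Finset.range M, ladderWeight N n = N - N ^ 2 / (N + M) := by
    induction M with
    | zero => simp; field_simp; simp
    | succ M ih => rw [Finset.sum_range_succ, ih, ladderWeight]; push_cast; field_simp; ring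
  rw [h]
  have : (0 : ℝ) ≤ N ^ 2 / (N + M) := by positivity
  linarith

lemma one_le_ladderWeight {N n : ℕ} (hn : n < N) : 1 ≤ 4 * ladderWeight N n := by
  have h : (n : ℝ) + 1 ≤ N := by exact_mod_cast hn
  have h0 : (0 : ℝ) ≤ n := n.cast_nonneg
  rw [ladderWeight, ← mul_div_assoc, one_le_div (by nlinarith)]
  nlinarith

lemma tendsto_ladderWeight_mul_sqrt (N : ℕ) :
    Tendsto (fun M : ℕ => ladderWeight N M * (Real.sqrt M + 1)) atTop (𝓝 0) := by
  have hlim : Tendsto (fun M : ℕ => 2 * (N : ℝ) ^ 2 * ((M : ℝ))⁻¹) atTop (𝓝 0) := by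
    simpa using (tendsto_inv_atTop_nhds_zero_nat (𝕜 := ℝ)).const_mul (2 * (N : ℝ) ^ 2)
  refine tendsto_of_tendsto_of_tendsto_of_le_of_le' tendsto_const_nhds hlim
    (Eventually.of_forall fun M => mul_nonneg (ladderWeight_nonneg _ _) (by positivity)) ?_
  filter_upwards [eventually_ge_atTop 1] with M hM
  have hM' : (1 : ℝ) ≤ M := by exact_mod_cast hM
  have h1 : Real.sqrt M + 1 ≤ 2 * M := by
    have : Real.sqrt M ≤ M := by
      rw [Real.sqrt_le_left (by positivity)]; nlinarith
    linarith
  calc ladderWeight N M * (Real.sqrt M + 1) ≤ N ^ 2 / (M * M) * (2 * M) := by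
        rw [ladderWeight]
        gcongr
        · linarith [(Nat.cast_nonneg N : (0 : ℝ) ≤ N)]
        · linarith [(Nat.cast_nonneg N : (0 : ℝ) ≤ N)]
    _ = _ := by field_simp

/-- Summation by parts moves the difference onto the weight, whose decay compensates the flux. The
weighted mass thus bounds its own derivative, up to a term that vanishes as `M → ∞`. -/
lemma abs_sum_ladderWeight_mul_flux_le (w : ℂ) (g : ℕ → ℝ → ℂ) {N : ℕ} (hN : 1 ≤ N)
    (M : ℕ) {Q t : ℝ} (hQ : ∀ n, ‖g n t‖ ^ 2 ≤ Q) :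
    |∑ n ∈ Finset.range M, ladderWeight N n * (ladderFlux w g (n + 1) t - ladderFlux w g n t)|
      ≤ 4 * ‖w‖ * (∑ n ∈ Finset.range M, ladderWeight N n * ‖g n t‖ ^ 2)
        + 2 * ‖w‖ * Q * (ladderWeight N M * (Real.sqrt M + 1)) := by
  have hφ := ladderWeight_nonneg N
  rw [sum_mul_sub_eq (φ := ladderWeight N) (F := fun n => ladderFlux w g n t)
    (ladderFlux_zero w g t)]
  have hbd : |ladderWeight N M * ladderFlux w g M t|
      ≤ 2 * ‖w‖ * Q * (ladderWeight N M * Real.sqrt M) := by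
    rw [abs_mul, abs_of_nonneg (hφ M)]
    calc _ ≤ ladderWeight N M * (‖w‖ * Real.sqrt M * (‖g M t‖ ^ 2 + ‖g (M - 1) t‖ ^ 2)) := by
          gcongr
          · exact hφ M
          · exact abs_ladderFlux_le w g M t
      _ ≤ ladderWeight N M * (‖w‖ * Real.sqrt M * (Q + Q)) := by
          gcongr
          · exact hφ M
          · exact hQ _
          · exact hQ _
      _ = _ := by ring
  have hterm : ∀ n, |(ladderWeight N n - ladderWeight N (n + 1)) * ladderFlux w g (n + 1) t|
      ≤ 2 * ‖w‖ * (ladderWeight N (n + 1) * ‖g (n + 1) t‖ ^ 2)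
        + 2 * ‖w‖ * (ladderWeight N n * ‖g n t‖ ^ 2) := by
    intro n
    have hd := sub_nonneg.2 (ladderWeight_succ_le hN n)
    rw [abs_mul, abs_of_nonneg hd]
    have h1 := abs_ladderFlux_le w g (n + 1) t
    rw [Nat.add_sub_cancel] at h1
    calc _ ≤ (ladderWeight N n - ladderWeight N (n + 1)) * (‖w‖ * Real.sqrt ((n + 1 : ℕ) : ℝ)
            * (‖g (n + 1) t‖ ^ 2 + ‖g n t‖ ^ 2)) := by gcongr
      _ = ‖w‖ * ((ladderWeight N n - ladderWeight N (n + 1)) * Real.sqrt ((n + 1 : ℕ) : ℝ))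
            * (‖g (n + 1) t‖ ^ 2 + ‖g n t‖ ^ 2) := by ring
      _ ≤ ‖w‖ * (2 * ladderWeight N (n + 1)) * (‖g (n + 1) t‖ ^ 2 + ‖g n t‖ ^ 2) := by
          have := ladderWeight_sub_mul_sqrt_le hN n
          exact mul_le_mul_of_nonneg_right (mul_le_mul_of_nonneg_left this (norm_nonneg w))
            (by positivity)
      _ = 2 * ‖w‖ * (ladderWeight N (n + 1) * ‖g (n + 1) t‖ ^ 2)
            + 2 * ‖w‖ * (ladderWeight N (n + 1) * ‖g n t‖ ^ 2) := by ring
      _ ≤ _ := by gcongr; exact ladderWeight_succ_le hN n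
  -- The index shift costs one top term; it accounts for the `+ 1` in `√M + 1`.
  have hshift : ∑ n ∈ Finset.range M, ladderWeight N (n + 1) * ‖g (n + 1) t‖ ^ 2
      ≤ (∑ n ∈ Finset.range M, ladderWeight N n * ‖g n t‖ ^ 2) + ladderWeight N M * Q := by
    have h1 := Finset.sum_range_succ' (fun n => ladderWeight N n * ‖g n t‖ ^ 2) M
    have h2 := Finset.sum_range_succ (fun n => ladderWeight N n * ‖g n t‖ ^ 2) M
    have h3 : 0 ≤ ladderWeight N 0 * ‖g 0 t‖ ^ 2 := mul_nonneg (hφ 0) (by positivity)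
    have h4 : ladderWeight N M * ‖g M t‖ ^ 2 ≤ ladderWeight N M * Q :=
      mul_le_mul_of_nonneg_left (hQ M) (hφ M)
    linarith
  have hsum : |∑ n ∈ Finset.range M,
        (ladderWeight N n - ladderWeight N (n + 1)) * ladderFlux w g (n + 1) t|
      ≤ 2 * ‖w‖ * (∑ n ∈ Finset.range M, ladderWeight N (n + 1) * ‖g (n + 1) t‖ ^ 2)
        + 2 * ‖w‖ * ∑ n ∈ Finset.range M, ladderWeight N n * ‖g n t‖ ^ 2 := by
    rw [Finset.mul_sum, Finset.mul_sum, ← Finset.sum_add_distrib]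
    exact (Finset.abs_sum_le_sum_abs _ _).trans (Finset.sum_le_sum fun n _ => hterm n)
  have hw : 0 ≤ 2 * ‖w‖ := by positivity
  have := mul_le_mul_of_nonneg_left hshift hw
  have := abs_add_le (ladderWeight N M * ladderFlux w g M t) (∑ n ∈ Finset.range M,
        (ladderWeight N n - ladderWeight N (n + 1)) * ladderFlux w g (n + 1) t)
  nlinarith

/-- A bounded ladder flow whose initial mass grows at most linearly keeps that property. -/
lemma IsLadderFlow.mass_le {w : ℂ} {g : ℕ → ℝ → ℂ} (hg : IsLadderFlow w g) {Q B : ℝ} (hB : 0 ≤ B)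
    (hQ : ∀ n, ∀ t ∈ Set.Icc (0 : ℝ) 1, ‖g n t‖ ^ 2 ≤ Q)
    (h0 : ∀ n : ℕ, ∑ k ∈ Finset.range n, ‖g k 0‖ ^ 2 ≤ B * n)
    (N : ℕ) {t : ℝ} (ht : t ∈ Set.Icc (0 : ℝ) 1) :
    ∑ n ∈ Finset.range N, ‖g n t‖ ^ 2 ≤ 4 * Real.exp (4 * ‖w‖) * B * N := by
  obtain rfl | hN := Nat.eq_zero_or_pos N
  · simp
  set Φ : ℕ → ℝ → ℝ := fun M t => ∑ n ∈ Finset.range M, ladderWeight N n * ‖g n t‖ ^ 2 with hΦ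
  have hΦ0 : ∀ M t, 0 ≤ Φ M t := fun M t =>
    Finset.sum_nonneg fun n _ => mul_nonneg (ladderWeight_nonneg N n) (by positivity)
  have hder : ∀ M t, HasDerivAt (Φ M) (∑ n ∈ Finset.range M,
      ladderWeight N n * (ladderFlux w g (n + 1) t - ladderFlux w g n t)) t := fun M t =>
    HasDerivAt.fun_sum fun n _ => (hg.hasDerivAt_norm_sq n t).const_mul _
  have hinit : ∀ M, ‖Φ M 0‖ ≤ B * N := fun M => by
    rw [Real.norm_of_nonneg (hΦ0 M 0)]
    refine (sum_mul_le_of_antitone (ladderWeight_nonneg N) (ladderWeight_succ_le hN) h0 M).trans ?_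
    gcongr
    exact sum_ladderWeight_le hN M
  -- `Q` enters only through the inhomogeneous term, which disappears as `M → ∞`.
  have hgron : ∀ M, Φ M t ≤ gronwallBound (B * N) (4 * ‖w‖)
      (2 * ‖w‖ * Q * (ladderWeight N M * (Real.sqrt M + 1))) t := fun M => by
    have := norm_le_gronwallBound_of_norm_deriv_right_le (f := Φ M) (a := 0) (b := 1)
      (δ := B * N) (K := 4 * ‖w‖)
      (ε := 2 * ‖w‖ * Q * (ladderWeight N M * (Real.sqrt M + 1)))
      (fun x _ => (hder M x).continuousAt.continuousWithinAt)
      (fun x _ => (hder M x).hasDerivWithinAt) (hinit M)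
      (fun x hx => by
        rw [Real.norm_of_nonneg (hΦ0 M x), Real.norm_eq_abs]
        exact abs_sum_ladderWeight_mul_flux_le w g hN M
          fun n => hQ n x ⟨hx.1, hx.2.le⟩) t ht
    rwa [Real.norm_of_nonneg (hΦ0 M t), sub_zero] at this
  have hlim : Tendsto (fun M : ℕ => gronwallBound (B * N) (4 * ‖w‖)
      (2 * ‖w‖ * Q * (ladderWeight N M * (Real.sqrt M + 1))) t) atTop
      (𝓝 (B * N * Real.exp (4 * ‖w‖ * t))) := by
    rw [← gronwallBound_ε0]
    refine ((gronwallBound_continuous_ε (B * N) (4 * ‖w‖) t).tendsto 0).comp ?_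
    simpa using (tendsto_ladderWeight_mul_sqrt N).const_mul (2 * ‖w‖ * Q)
  have hmass : ∀ M, N ≤ M → ∑ n ∈ Finset.range N, ‖g n t‖ ^ 2 ≤ 4 * Φ M t := fun M hM => by
    calc ∑ n ∈ Finset.range N, ‖g n t‖ ^ 2
        ≤ ∑ n ∈ Finset.range N, 4 * (ladderWeight N n * ‖g n t‖ ^ 2) := by
          refine Finset.sum_le_sum fun n hn => ?_
          have := one_le_ladderWeight (Finset.mem_range.1 hn)
          nlinarith [sq_nonneg ‖g n t‖]
      _ = 4 * Φ N t := by rw [Finset.mul_sum]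
      _ ≤ 4 * Φ M t := by
          gcongr
          exact Finset.sum_le_sum_of_subset_of_nonneg (Finset.range_subset_range.2 hM)
            fun n _ _ => mul_nonneg (ladderWeight_nonneg N n) (by positivity)
  have hle : ∑ n ∈ Finset.range N, ‖g n t‖ ^ 2 ≤ 4 * (B * N * Real.exp (4 * ‖w‖ * t)) := by
    refine ge_of_tendsto (hlim.const_mul 4) ?_
    filter_upwards [eventually_ge_atTop N] with M hM
    exact (hmass M hM).trans (by gcongr; exact hgron M)
  have hexp : Real.exp (4 * ‖w‖ * t) ≤ Real.exp (4 * ‖w‖) :=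
    Real.exp_le_exp.2 (mul_le_of_le_one_right (by positivity) ht.2)
  calc _ ≤ _ := hle
    _ ≤ 4 * (B * N * Real.exp (4 * ‖w‖)) := by gcongr
    _ = _ := by ring

/-- Averaged over a window of `M` levels, the mass of a ladder flow varies little. -/
lemma IsLadderFlow.abs_window_sub_le {w : ℂ} {g : ℕ → ℝ → ℂ} (hg : IsLadderFlow w g) {C : ℝ}
    (hC : ∀ n : ℕ, ∀ t ∈ Set.Icc (0 : ℝ) 1, ∑ k ∈ Finset.range n, ‖g k t‖ ^ 2 ≤ C * n)
    {N : ℕ} (hN : 1 ≤ N) (M : ℕ) :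
    |∑ m ∈ Finset.range M, ∑ k ∈ Finset.range (N + m), ‖g k 1‖ ^ 2
      - ∑ m ∈ Finset.range M, ∑ k ∈ Finset.range (N + m), ‖g k 0‖ ^ 2|
      ≤ 2 * ‖w‖ * C * (Real.sqrt ((N + M : ℕ) : ℝ) * ((N + M : ℕ) : ℝ)) := by
  have hder : ∀ t, HasDerivAt (fun t => ∑ m ∈ Finset.range M, ∑ k ∈ Finset.range (N + m),
      ‖g k t‖ ^ 2) (∑ m ∈ Finset.range M, ladderFlux w g (N + m) t) t := fun t =>
    HasDerivAt.fun_sum fun m _ => hg.hasDerivAt_mass (N + m) t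
  refine norm_image_sub_le_of_norm_deriv_le_segment_01' (E := ℝ)
    (fun t _ => (hder t).hasDerivWithinAt) fun t ht => ?_
  have hC' := hC (N + M) t ⟨ht.1, ht.2.le⟩
  have h1 : ∑ m ∈ Finset.range M, ‖g (N + m) t‖ ^ 2
      ≤ ∑ k ∈ Finset.range (N + M), ‖g k t‖ ^ 2 := by
    rw [Finset.sum_range_add]
    exact le_add_of_nonneg_left (Finset.sum_nonneg fun _ _ => by positivity)
  have h2 : ∑ m ∈ Finset.range M, ‖g (N + m - 1) t‖ ^ 2
      ≤ ∑ k ∈ Finset.range (N + M), ‖g k t‖ ^ 2 := by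
    -- `1 ≤ N` makes every `N + m - 1` a true predecessor, so index `0` is not counted twice.
    obtain ⟨K, rfl⟩ := Nat.exists_eq_add_of_le' hN
    rw [show K + 1 + M = K + M + 1 by ring, Finset.sum_range_succ, Finset.sum_range_add,
      show ∀ x, ∑ m ∈ Finset.range M, ‖g (K + 1 + m - 1) x‖ ^ 2
        = ∑ m ∈ Finset.range M, ‖g (K + m) x‖ ^ 2 from fun x =>
        Finset.sum_congr rfl fun m _ => by rw [show K + 1 + m - 1 = K + m by omega]]
    have : 0 ≤ ∑ k ∈ Finset.range K, ‖g k t‖ ^ 2 := Finset.sum_nonneg fun _ _ => by positivity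
    nlinarith [sq_nonneg ‖g (K + M) t‖]
  calc ‖∑ m ∈ Finset.range M, ladderFlux w g (N + m) t‖
      ≤ ∑ m ∈ Finset.range M, ‖w‖ * Real.sqrt ((N + M : ℕ) : ℝ)
          * (‖g (N + m) t‖ ^ 2 + ‖g (N + m - 1) t‖ ^ 2) := by
        refine (Finset.abs_sum_le_sum_abs _ _).trans (Finset.sum_le_sum fun m hm => ?_)
        refine (abs_ladderFlux_le w g (N + m) t).trans ?_
        have := (Finset.mem_range.1 hm).le
        gcongr
    _ = ‖w‖ * Real.sqrt ((N + M : ℕ) : ℝ) * (∑ m ∈ Finset.range M, ‖g (N + m) t‖ ^ 2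
          + ∑ m ∈ Finset.range M, ‖g (N + m - 1) t‖ ^ 2) := by
        rw [← Finset.mul_sum, Finset.sum_add_distrib]
    _ ≤ ‖w‖ * Real.sqrt ((N + M : ℕ) : ℝ) * (C * ((N + M : ℕ) : ℝ) + C * ((N + M : ℕ) : ℝ)) := by
        gcongr
        · exact h1.trans hC'
        · exact h2.trans hC'
    _ = _ := by ring

/-! ### Deterministic convergence -/

lemma isLadderFlow_radialLevel {a : ℕ → ℂ} (ha : ExpGrowth a) (w : ℂ) :
    IsLadderFlow w (radialLevel a w) := hasDerivAt_radialLevel ha w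

lemma radialLevel_zero_right {a : ℕ → ℂ} (ha : ExpGrowth a) (w : ℂ) (n : ℕ) :
    radialLevel a w n 0 = a n := by
  simp [radialLevel, landauField_zero_right ha]

lemma radialLevel_one_right (a : ℕ → ℂ) (w : ℂ) (n : ℕ) :
    radialLevel a w n 1 = (Real.exp (-‖w‖ ^ 2 / 2) : ℂ) * landauField a n w := by
  simp [radialLevel]

lemma norm_radialLevel_le (a : ℕ → ℂ) (w : ℂ) (n : ℕ) (t : ℝ) :
    ‖radialLevel a w n t‖ ≤ ‖landauField a n (t * w)‖ := by
  rw [radialLevel, norm_mul, Complex.norm_real, Real.norm_of_nonneg (Real.exp_nonneg _)]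
  refine mul_le_of_le_one_left (norm_nonneg _) (Real.exp_le_one_iff.2 ?_)
  have : 0 ≤ ‖(t : ℂ) * w‖ ^ 2 := by positivity
  linarith

lemma tendsto_radialLevel_truncCoeff {a : ℕ → ℂ} (ha : ExpGrowth a) (w : ℂ) (n : ℕ) (t : ℝ) :
    Tendsto (fun L => radialLevel (truncCoeff a L) w n t) atTop (𝓝 (radialLevel a w n t)) := by
  simp only [radialLevel, landauField_eq ha, fun L => landauField_eq (ha.truncCoeff L)]
  exact ((tendsto_landauTower_truncCoeff ha n 0 _).const_mul _).const_mul _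

lemma expGrowth_of_sum_norm_sq_le {a : ℕ → ℂ} {B : ℝ} (hB : 0 ≤ B)
    (h : ∀ n : ℕ, ∑ k ∈ Finset.range n, ‖a k‖ ^ 2 ≤ B * n) : ExpGrowth a := by
  refine ⟨B + 1, 2, by positivity, by norm_num, fun k => ?_⟩
  have h1 : ‖a k‖ ^ 2 ≤ B * (k + 1 : ℕ) :=
    (Finset.single_le_sum (f := fun k => ‖a k‖ ^ 2) (fun _ _ => by positivity)
      (Finset.self_mem_range_succ k)).trans (h (k + 1))
  have h2 : ((k + 1 : ℕ) : ℝ) ≤ 2 ^ k := by exact_mod_cast Nat.lt_two_pow_self (n := k)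
  have h3 : B * ((k + 1 : ℕ) : ℝ) ≤ B * 2 ^ k := by gcongr
  have h4 : (1 : ℝ) ≤ 2 ^ k := one_le_pow₀ one_le_two
  nlinarith [sq_nonneg (‖a k‖ - 1)]

/-- Linear growth of the mass is propagated along the rays. -/
lemma sum_norm_sq_radialLevel_le {a : ℕ → ℂ} {B : ℝ} (hB : 0 ≤ B)
    (h : ∀ n : ℕ, ∑ k ∈ Finset.range n, ‖a k‖ ^ 2 ≤ B * n) (w : ℂ) (N : ℕ) {t : ℝ}
    (ht : t ∈ Set.Icc (0 : ℝ) 1) :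
    ∑ n ∈ Finset.range N, ‖radialLevel a w n t‖ ^ 2 ≤ 4 * Real.exp (4 * ‖w‖) * B * N := by
  have ha := expGrowth_of_sum_norm_sq_le hB h
  refine le_of_tendsto (tendsto_finsetSum _ fun n _ =>
    ((tendsto_radialLevel_truncCoeff ha w n t).norm.pow 2)) (Eventually.of_forall fun L => ?_)
  -- `Q` depends on `L`, but the mass bound it unlocks does not.
  obtain ⟨Q, hQ⟩ := exists_bound_landauField_truncCoeff ha L ‖w‖
  refine (isLadderFlow_radialLevel (ha.truncCoeff L) w).mass_le (Q := Q ^ 2) hB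
    (fun n s hs => ?_) (fun n => ?_) N ht
  · have hs' : ‖(s : ℂ) * w‖ ≤ ‖w‖ := by
      rw [norm_mul, Complex.norm_real, Real.norm_of_nonneg hs.1]
      exact mul_le_of_le_one_left (norm_nonneg _) hs.2
    have := (norm_radialLevel_le (truncCoeff a L) w n s).trans (hQ n _ hs')
    gcongr
  · refine le_trans (Finset.sum_le_sum fun k _ => ?_) (h n)
    rw [radialLevel_zero_right (ha.truncCoeff L)]
    have := norm_truncCoeff_le a L k
    gcongr

/-- If the partial sums `A n` of a nonnegative sequence satisfy `A n / n → 1` and `T n` is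
sandwiched between them up to a shift by `M` and an error of order `n ^ (3/2) / M`, then
`T n / n → 1`, uniformly in the parameter. -/
lemma tendstoUniformlyOn_of_window {ι : Type*} {K : Set ι} {A : ℕ → ℝ} {T : ℕ → ι → ℝ} {c : ℝ}
    (hc : 0 ≤ c) (hA : Tendsto (fun n : ℕ => A n / n) atTop (𝓝 1))
    (hup : ∀ z ∈ K, ∀ N M : ℕ, 1 ≤ N →
      M * T N z ≤ M * A (N + M) + c * (Real.sqrt ((N + M : ℕ) : ℝ) * ((N + M : ℕ) : ℝ)))
    (hlow : ∀ z ∈ K, ∀ N M : ℕ, 1 ≤ N →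
      M * A N ≤ M * T (N + M) z + c * (Real.sqrt ((N + M : ℕ) : ℝ) * ((N + M : ℕ) : ℝ))) :
    TendstoUniformlyOn (fun (N : ℕ) z => T N z / N) (fun _ => (1 : ℝ)) atTop K := by
  rw [Metric.tendstoUniformlyOn_iff]
  intro ε hε
  obtain ⟨δ, hδ, hδ1, hδε⟩ : ∃ δ : ℝ, 0 < δ ∧ δ ≤ 1 / 4 ∧ 8 * δ ≤ ε :=
    ⟨min (1 / 4) (ε / 8), by positivity, min_le_left _ _, by
      have := min_le_right (1 / 4) (ε / 8); linarith⟩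
  obtain ⟨n₀, hn₀⟩ := (Metric.tendsto_atTop.1 hA) δ hδ
  have hA' : ∀ n, n₀ ≤ n → 1 ≤ n → (1 - δ) * n ≤ A n ∧ A n ≤ (1 + δ) * n := by
    intro n hn h1
    have hn' : (0 : ℝ) < n := by exact_mod_cast h1
    have := hn₀ n hn
    rw [Real.dist_eq, abs_lt] at this
    constructor
    · rw [← le_div_iff₀ hn']; linarith
    · rw [← div_le_iff₀ hn']; linarith
  have hlim : Tendsto (fun N : ℕ => Real.sqrt (N : ℝ)) atTop atTop :=
    Real.tendsto_sqrt_atTop.comp tendsto_natCast_atTop_atTop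
  -- The thresholds ensure, in order, `N - M ≥ n₀`, a flux error at most `δN` after division by `M`,
  -- and a ceiling `M ≤ 2δN`.
  filter_upwards [eventually_ge_atTop (2 * n₀ + 4), hlim.eventually_ge_atTop (4 * c / δ ^ 2),
    tendsto_natCast_atTop_atTop.eventually_ge_atTop (1 / δ)] with N hN hN1 hN2 z hz
  have hNpos : (0 : ℝ) < N := by exact_mod_cast (by omega : 0 < N)
  have hNδ : 1 ≤ δ * N := by rw [div_le_iff₀ hδ] at hN2; linarith
  set M : ℕ := ⌈δ * (N : ℝ)⌉₊ with hM
  have hM1 : δ * N ≤ M := Nat.le_ceil _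
  have hM2 : (M : ℝ) ≤ 2 * δ * N := by
    have := Nat.ceil_lt_add_one (a := δ * (N : ℝ)) (by positivity)
    linarith
  have hMpos : (0 : ℝ) < M := by linarith
  have hMN : 2 * M ≤ N := by
    have : (2 * M : ℝ) ≤ N := by nlinarith
    exact_mod_cast this
  have hcs : 4 * c ≤ δ ^ 2 * Real.sqrt N := by
    rw [div_le_iff₀ (by positivity)] at hN1; linarith
  have herr : ∀ P : ℕ, (P : ℝ) ≤ 2 * N →
      c * (Real.sqrt (P : ℝ) * (P : ℝ)) ≤ M * (δ * N) := by
    intro P hP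
    have h1 : Real.sqrt (P : ℝ) ≤ 2 * Real.sqrt N := by
      rw [Real.sqrt_le_left (by positivity), mul_pow, Real.sq_sqrt hNpos.le]; linarith
    have hs : Real.sqrt N * Real.sqrt N = N := Real.mul_self_sqrt hNpos.le
    calc c * (Real.sqrt (P : ℝ) * (P : ℝ)) ≤ c * (2 * Real.sqrt N * (2 * N)) := by gcongr
      _ = 4 * c * Real.sqrt N * N := by ring
      _ ≤ δ ^ 2 * Real.sqrt N * Real.sqrt N * N := by gcongr
      _ = δ * N * (δ * N) := by rw [mul_assoc (δ ^ 2), hs]; ring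
      _ ≤ M * (δ * N) := by gcongr
  -- `(1 + δ)(1 + 2δ) + δ ≤ 1 + 5δ` because `δ ≤ 1/4`. The lower bound is analogous, with the window
  -- starting at `N - M`.
  have hupper : T N z ≤ (1 + 5 * δ) * N := by
    have h1 := hup z hz N M (by omega)
    have h2 := (hA' (N + M) (by omega) (by omega)).2
    have h3 := herr (N + M) (by push_cast; nlinarith)
    have h4 : T N z ≤ A (N + M) + δ * N := by
      have : (M : ℝ) * T N z ≤ M * (A (N + M) + δ * N) := by linarith
      exact le_of_mul_le_mul_left this hMpos
    push_cast at h2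
    nlinarith [mul_pos hδ hNpos, mul_le_mul_of_nonneg_left hM2 hδ.le]
  have hlower : (1 - 5 * δ) * N ≤ T N z := by
    have h1 := hlow z hz (N - M) M (by omega)
    have h2 := (hA' (N - M) (by omega) (by omega)).1
    rw [Nat.sub_add_cancel (by omega : M ≤ N)] at h1
    have h3 := herr N (by linarith)
    have h4 : A (N - M) ≤ T N z + δ * N := by
      have : (M : ℝ) * A (N - M) ≤ M * (T N z + δ * N) := by linarith
      exact le_of_mul_le_mul_left this hMpos
    rw [Nat.cast_sub (by omega : M ≤ N)] at h2
    nlinarith [mul_pos hδ hNpos, mul_pos hδ hMpos]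
  rw [Real.dist_eq, abs_sub_comm, abs_lt]
  constructor
  · have := (le_div_iff₀ hNpos).2 hlower
    linarith
  · have := (div_le_iff₀ hNpos).2 hupper
    linarith

/-- If the squares of the coefficients have Cesàro mean one, then the averaged field converges
to one, uniformly on compact sets. -/
theorem tendstoUniformlyOn_averagedField {a : ℕ → ℂ}
    (h : Tendsto (fun n : ℕ => (∑ k ∈ Finset.range n, ‖a k‖ ^ 2) / n) atTop (𝓝 1))
    {K : Set ℂ} (hK : IsCompact K) :
    (∀ N, Continuous (averagedField a N)) ∧
      TendstoUniformlyOn (averagedField a) (fun _ => (1 : ℝ)) atTop K := by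
  obtain ⟨B, hB⟩ := h.bddAbove_range
  have hB' : ∀ n : ℕ, (∑ k ∈ Finset.range n, ‖a k‖ ^ 2) / n ≤ B := fun n =>
    hB (Set.mem_range_self n)
  -- The entry `n = 0` is `0 / 0 = 0`.
  have hB0 : 0 ≤ B := by simpa using hB' 0
  have hlin : ∀ n : ℕ, ∑ k ∈ Finset.range n, ‖a k‖ ^ 2 ≤ B * n := by
    intro n
    obtain rfl | hn := Nat.eq_zero_or_pos n
    · simp
    · exact (div_le_iff₀ (by exact_mod_cast hn)).1 (hB' n)
  have ha := expGrowth_of_sum_norm_sq_le hB0 hlin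
  refine ⟨continuous_averagedField ha, ?_⟩
  obtain ⟨R, hR⟩ := hK.isBounded.exists_norm_le
  obtain ⟨R', hR', hRR⟩ : ∃ R' : ℝ, 0 ≤ R' ∧ ∀ z ∈ K, ‖z‖ ≤ R' :=
    ⟨max R 0, le_max_right _ _, fun z hz => (hR z hz).trans (le_max_left _ _)⟩
  set C : ℝ := 4 * Real.exp (4 * R') * B with hC
  have hC0 : 0 ≤ C := by positivity
  set A : ℕ → ℝ := fun n => ∑ k ∈ Finset.range n, ‖a k‖ ^ 2 with hAdef
  set T : ℕ → ℂ → ℝ := fun n z => ∑ k ∈ Finset.range n, ‖radialLevel a z k 1‖ ^ 2 with hTdef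
  have hAmono : Monotone A := fun m n hmn =>
    Finset.sum_le_sum_of_subset_of_nonneg (Finset.range_subset_range.2 hmn)
      fun _ _ _ => by positivity
  have hTmono : ∀ z, Monotone fun n => T n z := fun z m n hmn =>
    Finset.sum_le_sum_of_subset_of_nonneg (Finset.range_subset_range.2 hmn)
      fun _ _ _ => by positivity
  have hwin : ∀ z ∈ K, ∀ N M : ℕ, 1 ≤ N →
      |∑ m ∈ Finset.range M, T (N + m) z - ∑ m ∈ Finset.range M, A (N + m)|
        ≤ 2 * R' * C * (Real.sqrt ((N + M : ℕ) : ℝ) * ((N + M : ℕ) : ℝ)) := by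
    intro z hz N M hN
    have hz' := hRR z hz
    have hmass : ∀ n : ℕ, ∀ t ∈ Set.Icc (0 : ℝ) 1,
        ∑ k ∈ Finset.range n, ‖radialLevel a z k t‖ ^ 2 ≤ C * n := by
      intro n t ht
      refine (sum_norm_sq_radialLevel_le hB0 hlin z n ht).trans ?_
      rw [hC]
      gcongr
    have := (isLadderFlow_radialLevel ha z).abs_window_sub_le hmass hN M
    simp only [radialLevel_zero_right ha] at this
    refine this.trans ?_
    gcongr
  -- Partial masses are monotone in the level, so a window average lies between its end values.
  have key := tendstoUniformlyOn_of_window (K := K) (A := A) (T := T) (c := 2 * R' * C)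
    (by positivity) h
    (fun z hz N M hN => by
      have h1 := (abs_le.1 (hwin z hz N M hN)).2
      have h2 : (M : ℝ) * T N z ≤ ∑ m ∈ Finset.range M, T (N + m) z := by
        have := Finset.card_nsmul_le_sum (Finset.range M) (fun m => T (N + m) z) (T N z)
          fun m _ => hTmono z (Nat.le_add_right N m)
        simpa using this
      have h3 : ∑ m ∈ Finset.range M, A (N + m) ≤ (M : ℝ) * A (N + M) := by
        have := Finset.sum_le_card_nsmul (Finset.range M) (fun m => A (N + m)) (A (N + M))
          fun m hm => hAmono (by have := Finset.mem_range.1 hm; omega)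
        simpa using this
      linarith)
    (fun z hz N M hN => by
      have h1 := (abs_le.1 (hwin z hz N M hN)).1
      have h2 : (M : ℝ) * A N ≤ ∑ m ∈ Finset.range M, A (N + m) := by
        have := Finset.card_nsmul_le_sum (Finset.range M) (fun m => A (N + m)) (A N)
          fun m _ => hAmono (Nat.le_add_right N m)
        simpa using this
      have h3 : ∑ m ∈ Finset.range M, T (N + m) z ≤ (M : ℝ) * T (N + M) z := by
        have := Finset.sum_le_card_nsmul (Finset.range M) (fun m => T (N + m) z) (T (N + M) z)
          fun m hm => hTmono z (by have := Finset.mem_range.1 hm; omega)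
        simpa using this
      linarith)
  refine key.congr (Eventually.of_forall fun N z _ => ?_)
  simp only [hTdef, averagedField, radialLevel_one_right]
  ring

/-! ### The law of large numbers -/

lemma integrable_sq_gaussianReal (v : NNReal) :
    Integrable (fun x : ℝ => x ^ 2) (gaussianReal 0 v) := by
  simpa using (memLp_id_gaussianReal (μ := 0) (v := v) 2).integrable_sq

lemma integral_sq_gaussianReal (v : NNReal) : ∫ x, x ^ 2 ∂(gaussianReal 0 v) = v := by
  have h := variance_fun_id_gaussianReal (μ := 0) (v := v)
  rwa [variance_of_integral_eq_zero (by fun_prop) (by simp)] at h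

lemma norm_sq_add_mul_I (p : ℝ × ℝ) :
    ‖(p.1 : ℂ) + (p.2 : ℂ) * Complex.I‖ ^ 2 = p.1 ^ 2 + p.2 ^ 2 := by
  rw [Complex.sq_norm, Complex.normSq_add_mul_I]

lemma integrable_norm_sq_stdComplexGaussian :
    Integrable (fun z : ℂ => ‖z‖ ^ 2) stdComplexGaussian := by
  rw [stdComplexGaussian, integrable_map_measure (by fun_prop) (by fun_prop)]
  simp only [Function.comp_def, norm_sq_add_mul_I]
  exact ((integrable_sq_gaussianReal _).comp_fst _).add ((integrable_sq_gaussianReal _).comp_snd _)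

lemma integral_norm_sq_stdComplexGaussian : ∫ z, ‖z‖ ^ 2 ∂stdComplexGaussian = 1 := by
  rw [stdComplexGaussian, integral_map (by fun_prop) (by fun_prop)]
  simp only [norm_sq_add_mul_I]
  rw [integral_add ((integrable_sq_gaussianReal _).comp_fst _)
    ((integrable_sq_gaussianReal _).comp_snd _),
    integral_fun_fst (fun x : ℝ => x ^ 2), integral_fun_snd (fun x : ℝ => x ^ 2)]
  simp only [integral_sq_gaussianReal]
  norm_num

/-- The `|ζₖ|²` are pairwise independent, identically distributed and integrable with mean `1/2 +
1/2`, so the strong law applies. -/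
lemma ae_tendsto_average_norm_sq {Ω : Type*} [MeasurableSpace Ω] (P : Measure Ω)
    (ζ : ℕ → Ω → ℂ) (hlaw : ∀ k, HasLaw (ζ k) stdComplexGaussian P) (hindep : iIndepFun ζ P) :
    ∀ᵐ ω ∂P, Tendsto (fun n : ℕ => (∑ k ∈ Finset.range n, ‖ζ k ω‖ ^ 2) / n) atTop (𝓝 1) := by
  have hm : Measurable fun z : ℂ => ‖z‖ ^ 2 := by fun_prop
  have hint : ∫ ω, ‖ζ 0 ω‖ ^ 2 ∂P = 1 := by
    rw [← integral_norm_sq_stdComplexGaussian]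
    exact (hlaw 0).integral_comp hm.aestronglyMeasurable
  have hi : Integrable (fun ω => ‖ζ 0 ω‖ ^ 2) P := by
    have h := integrable_norm_sq_stdComplexGaussian
    rw [← (hlaw 0).map_eq] at h
    exact h.comp_aemeasurable (hlaw 0).aemeasurable
  rw [← hint]
  exact strong_law_ae_real (fun k ω => ‖ζ k ω‖ ^ 2) hi
    (fun i j hij => (hindep.indepFun hij).comp hm hm)
    (fun k => ((hlaw k).identDistrib (hlaw 0)).comp hm)

theorem theorem2p3 {Ω : Type*} [MeasurableSpace Ω] (P : Measure Ω) [IsProbabilityMeasure P]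
    (ζ : ℕ → Ω → ℂ) (hlaw : ∀ k, HasLaw (ζ k) stdComplexGaussian P) (hindep : iIndepFun ζ P)
    (K : Set ℂ) (hK : IsCompact K) :
    ∀ᵐ ω ∂P,
      (∀ N : ℕ, ContinuousOn (averagedField (fun k => ζ k ω) N) K) ∧
      TendstoUniformlyOn (fun N : ℕ => averagedField (fun k => ζ k ω) N)
        (fun _ => (1 : ℝ)) atTop K := by
  filter_upwards [ae_tendsto_average_norm_sq P ζ hlaw hindep] with ω hω
  obtain ⟨hcont, hlim⟩ := tendstoUniformlyOn_averagedField hω hK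
  exact ⟨fun N => (hcont N).continuousOn, hlim⟩
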